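/- Let $k\ge 0$, let $\Omega$ be a known positive-definite $(k+1)\times(k+1)$ correlation matrix, and let $Y=(Y_\beta,Y_\delta)\sim N((\beta,\delta),\Omega)$, where $\beta\in\mathbb{R}$ is the unrestricted parameter of interest and $\delta\in\mathbb{R}^k$ is a nuisance parameter known to satisfy $\delta\ge 0$ coordinatewise. Let $\alpha\in(0,1)$, and let $z_q$ be the $q$-quantile of the standard normal distribution. An upper one-sided CI is an interval $[\mathrm{lb}(Y),\infty)$ with $\mathrm{lb}$ a measurable real-valued function; it is called valid if $P_{\beta,\delta}(\beta\ge \mathrm{lb}(Y))\ge 1-\alpha$ for all $\beta\in\mathbb{R}$ and all $\delta\ge0$. Its excess length is $\beta-\mathrm{lb}(Y)$. The $q$-quantile of a real random variable $X$ is $\inf\{x: P(X\le x)\ge q\}$. For $s\subseteq\{1,\dots,k\}$ (possibly empty) let $\delta^{(s)}$, $Y_{\delta^{(s)}}$ be the corresponding subvectors, let $\Omega_{\beta\delta^{(s)}}$, $\Omega_{\delta^{(s)}\delta^{(s)}}$, $\Omega_{\delta^{(s)}\beta}$ be the corresponding blocks of $\Omega$, and put $R_s=\Omega_{\beta\delta^{(s)}}\Omega_{\delta^{(s)}\delta^{(s)}}^{-1}\Omega_{\delta^{(s)}\beta}$,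 where all terms with $s=\emptyset$ are zero. (i) The CI $[Y_\beta-z_{1-\alpha},\infty)$ is valid, and among all valid upper one-sided CIs it minimizes, simultaneously for every $q\in(\alpha,1)$, the supremum of the $q$-quantile of excess length over the parameter space $\{(\beta,\delta):\delta\ge0\}$; it also minimizes, for each fixed $\beta$, the supremum over $\delta\ge0$. Any valid upper one-sided CI that minimizes these suprema over $\{(\beta,\delta):\delta\ge 0\}$ for all $q\in(\alpha,1)$ has almost surely the same lower end point. (ii) Among the subvectors $\delta^{(s)}$ for which all elements of $\Omega_{\beta\delta^{(s)}}\Omega_{\delta^{(s)}\delta^{(s)}}^{-1}$ are nonnegative there is one that maximizes $R_s$. For every such maximizer $s^*$, the CI \[\Bigl[Y_\beta-\Omega_{\beta\delta^{(s^*)}}\Omega_{\delta^{(s^*)}\delta^{(s^*)}}^{-1}Y_{\delta^{(s^*)}}-z_{1-\alpha}\sqrt{1-R_{s^*}},\ \infty\Bigr)\] is valid, and among all valid upper one-sided CIs it minimizes, simultaneously for every $q\in(\alpha,1)$, the $q$-quantile of excess length at $\delta=0$, both at each fixed $\beta$ and in the supremum over $\beta\in\mathbb{R}$. Any valid upper one-sided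 CI that minimizes these suprema over $\{(\beta,0):\beta\in\mathbb{R}\}$ for all $q\in(\alpha,1)$ has almost surely the same lower end point. -/

import Mathlib

open MeasureTheory ProbabilityTheory Matrix

noncomputable section

/-- The `q`-quantile `inf {x | μ (-∞, x] ≥ q}` of a probability measure `μ` on `ℝ`; it is used for
levels `q` strictly between `0` and `1`, for which the set is nonempty and bounded below. -/
def quantile (μ : Measure ℝ) (q : ℝ) : ℝ := sInf {x : ℝ | q ≤ μ.real (Set.Iic x)}

/-- The quantile `z_q` of the standard normal distribution. -/
def zQuantile (q : ℝ) : ℝ := quantile (gaussianReal 0 1) q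

/-- The mean vector `(β, δ)`. Coordinate `0` belongs to `β`, coordinate `i.succ` to `δ i`. -/
def meanVector {k : ℕ} (β : ℝ) (δ : Fin k → ℝ) : EuclideanSpace ℝ (Fin (k + 1)) :=
  WithLp.toLp 2 (Fin.cons β δ : Fin (k + 1) → ℝ)

/-- The law `N((β, δ), Ω)` of the observation `Y = (Y_β, Y_δ)`. -/
def limitLaw {k : ℕ} (Ω : Matrix (Fin (k + 1)) (Fin (k + 1)) ℝ) (β : ℝ) (δ : Fin k → ℝ) :
    Measure (EuclideanSpace ℝ (Fin (k + 1))) :=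
  multivariateGaussian (meanVector β δ) Ω

/-- The parameter space: `(β, δ)` with `β` unrestricted and `δ ≥ 0` coordinatewise. -/
def paramSpace (k : ℕ) : Set (ℝ × (Fin k → ℝ)) := {p | ∀ i, 0 ≤ p.2 i}

/-- `lb` is the lower end point of an upper one-sided confidence interval `[lb(Y), ∞)` for `β`
whose coverage probability is at least `1 - α` for all `β` and all `δ ≥ 0`. -/
def IsUpperCI {k : ℕ} (Ω : Matrix (Fin (k + 1)) (Fin (k + 1)) ℝ) (α : ℝ)
    (lb : EuclideanSpace ℝ (Fin (k + 1)) → ℝ) : Prop :=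
  Measurable lb ∧
    ∀ p ∈ paramSpace k, 1 - α ≤ (limitLaw Ω p.1 p.2).real {y | p.1 ∈ Set.Ici (lb y)}

/-- The `q`-quantile of the excess length `β - lb(Y)` of `[lb(Y), ∞)` under `N((β, δ), Ω)`. -/
def excessQuantile {k : ℕ} (Ω : Matrix (Fin (k + 1)) (Fin (k + 1)) ℝ)
    (lb : EuclideanSpace ℝ (Fin (k + 1)) → ℝ) (q β : ℝ) (δ : Fin k → ℝ) : ℝ :=
  quantile ((limitLaw Ω β δ).map (fun y => β - lb y)) q

/-- The maximum (possibly infinite) of the `q`-quantile of the excess length over the set `G` of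
parameters. -/
def maxExcessQuantile {k : ℕ} (Ω : Matrix (Fin (k + 1)) (Fin (k + 1)) ℝ)
    (lb : EuclideanSpace ℝ (Fin (k + 1)) → ℝ) (q : ℝ) (G : Set (ℝ × (Fin k → ℝ))) : EReal :=
  ⨆ p ∈ G, ((excessQuantile Ω lb q p.1 p.2 : ℝ) : EReal)

/-- `[lb(Y), ∞)` has coverage at least `1 - α` over the whole parameter space, and among all upper
one-sided confidence intervals with this property it minimizes the maximum over `G` of the
`q`-quantile of excess length, simultaneously for all levels `q` greater than `α`. -/
def IsOptimalCI {k : ℕ} (Ω : Matrix (Fin (k + 1)) (Fin (k + 1)) ℝ) (α : ℝ)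
    (G : Set (ℝ × (Fin k → ℝ))) (lb : EuclideanSpace ℝ (Fin (k + 1)) → ℝ) : Prop :=
  IsUpperCI Ω α lb ∧
    ∀ lb' : EuclideanSpace ℝ (Fin (k + 1)) → ℝ, IsUpperCI Ω α lb' →
      ∀ q ∈ Set.Ioo α 1, maxExcessQuantile Ω lb q G ≤ maxExcessQuantile Ω lb' q G

/-- The row vector `Ω_{βδ(s)}`, for the subvector `δ(s)` of `δ` with index set `s`. -/
def crossCov {k : ℕ} (Ω : Matrix (Fin (k + 1)) (Fin (k + 1)) ℝ) (s : Finset (Fin k)) : s → ℝ :=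
  fun i => Ω 0 (i : Fin k).succ

/-- The square block `Ω_{δ(s)δ(s)}`. -/
def subCov {k : ℕ} (Ω : Matrix (Fin (k + 1)) (Fin (k + 1)) ℝ) (s : Finset (Fin k)) :
    Matrix s s ℝ :=
  Ω.submatrix (fun i => (i : Fin k).succ) (fun i => (i : Fin k).succ)

/-- The row vector of regression coefficients `Ω_{βδ(s)} Ω_{δ(s)δ(s)}⁻¹`. -/
def regCoef {k : ℕ} (Ω : Matrix (Fin (k + 1)) (Fin (k + 1)) ℝ) (s : Finset (Fin k)) : s → ℝ :=
  crossCov Ω s ᵥ* (subCov Ω s)⁻¹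

/-- The number `Ω_{βδ(s)} Ω_{δ(s)δ(s)}⁻¹ Ω_{δ(s)β}`; it is `0` for the empty subvector. -/
def explained {k : ℕ} (Ω : Matrix (Fin (k + 1)) (Fin (k + 1)) ℝ) (s : Finset (Fin k)) : ℝ :=
  regCoef Ω s ⬝ᵥ fun i => Ω (i : Fin k).succ 0

/-- `s` maximizes `Ω_{βδ(s)} Ω_{δ(s)δ(s)}⁻¹ Ω_{δ(s)β}` among all (possibly empty) subvectors whose
regression coefficients are all nonnegative. -/
def IsBestSubvector {k : ℕ} (Ω : Matrix (Fin (k + 1)) (Fin (k + 1)) ℝ)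
    (s : Finset (Fin k)) : Prop :=
  (∀ i, 0 ≤ regCoef Ω s i) ∧
    ∀ t : Finset (Fin k), (∀ i, 0 ≤ regCoef Ω t i) → explained Ω t ≤ explained Ω s

/-- Lower end point `Y_β - z_{1-α}` of the standard upper one-sided confidence interval. -/
def standardLB {k : ℕ} (α : ℝ) (y : EuclideanSpace ℝ (Fin (k + 1))) : ℝ :=
  y 0 - zQuantile (1 - α)

/-- Lower end point
`Y_β - Ω_{βδ(s)} Ω_{δ(s)δ(s)}⁻¹ Y_{δ(s)} - z_{1-α} √(1 - Ω_{βδ(s)} Ω_{δ(s)δ(s)}⁻¹ Ω_{δ(s)β})`. -/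
def subvectorLB {k : ℕ} (Ω : Matrix (Fin (k + 1)) (Fin (k + 1)) ℝ) (α : ℝ) (s : Finset (Fin k))
    (y : EuclideanSpace ℝ (Fin (k + 1))) : ℝ :=
  y 0 - (regCoef Ω s ⬝ᵥ fun i => y (i : Fin k).succ)
    - zQuantile (1 - α) * Real.sqrt (1 - explained Ω s)

end

/-! Both parts are one Neyman–Pearson argument for a linear statistic `⟨a, Y⟩` with `a 0 = 1`,
nonpositive other coefficients, and `σ²` equal both to its variance and to its covariance with `Y_β`
(`IsDominatedStatistic`). The sign condition gives `E⟨a, Y⟩ ≤ β` whenever `δ ≥ 0`, hence validity.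
For optimality, fix an alternative `(β, δ)` with `E⟨a, Y⟩ = β` and move back by `(t/σ²) Ωa`. By
Cameron–Martin (`tilted_multivariateGaussian`) the log likelihood ratio of the two points is affine
in `⟨a, y⟩`, and the new first coordinate is `β - t`. If the new point still has a nonnegative
nuisance part, a valid interval excludes `β - t` there with probability at most `α`, so by
`neymanPearson_tilted` it cannot exclude `β - t` under `(β, δ)` more often than the linear interval
does (`power_le`). Varying `t` turns this into a lower bound for the quantiles of excess length.

In part (i), `a` is the first unit vector and `δ` is taken large enough to absorb the shift. In part
(ii), `a` is the residual of `Y_β` regressed on `Y_{δ(s)}`; at `δ = 0` the shift is admissible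
exactly when this residual is nonpositively correlated with every nuisance coordinate. These are the
first-order conditions for minimizing `wᵀΩ_{δδ}w - 2wᵀΩ_{δβ}` over `w ≥ 0`, and a best subvector
yields a minimizer (`IsBestSubvector.cross_le`).

Uniqueness comes from the equality case of Neyman–Pearson: an optimal lower end point exceeds `b` on
almost the same event as the linear one, for a countable dense set of `b`. -/

/-! ### Quantiles of real laws and of the standard normal. -/

lemma quantile_le_iff (μ : Measure ℝ) [IsProbabilityMeasure μ] {q : ℝ} (hq : q ∈ Set.Ioo (0 : ℝ) 1)
    (x : ℝ) : quantile μ q ≤ x ↔ q ≤ μ.real (Set.Iic x) := by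
  have hne : {x : ℝ | q ≤ μ.real (Set.Iic x)}.Nonempty := by
    obtain ⟨y, hy⟩ := ((tendsto_cdf_atTop μ).eventually (lt_mem_nhds hq.2)).exists
    exact ⟨y, by simpa [cdf_eq_real] using hy.le⟩
  have hbdd : BddBelow {x : ℝ | q ≤ μ.real (Set.Iic x)} := by
    obtain ⟨y, hy⟩ := ((tendsto_cdf_atBot μ).eventually (gt_mem_nhds hq.1)).exists
    refine ⟨y, fun w hw => ?_⟩
    by_contra! h
    have h1 := monotone_cdf μ h.le
    rw [Set.mem_ofPred_eq, ← cdf_eq_real] at hw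
    linarith
  -- Right continuity of the distribution function makes the infimum attained.
  have hmem : q ≤ μ.real (Set.Iic (quantile μ q)) := by
    rw [← cdf_eq_real]
    have hc := ((cdf μ).right_continuous (quantile μ q)).tendsto
    have hc' := hc.mono_left (nhdsWithin_mono _ Set.Ioi_subset_Ici_self)
    refine ge_of_tendsto hc' ?_
    filter_upwards [self_mem_nhdsWithin] with y hy
    obtain ⟨w, hw, hwy⟩ := exists_lt_of_csInf_lt hne hy
    rw [Set.mem_ofPred_eq, ← cdf_eq_real] at hw
    exact hw.trans (monotone_cdf μ hwy.le)
  refine ⟨fun h => hmem.trans (measureReal_mono (Set.Iic_subset_Iic.2 h)), fun h => csInf_le hbdd h⟩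

lemma real_Iic_quantile (μ : Measure ℝ) [IsProbabilityMeasure μ] [NullSingletonClass μ] {q : ℝ}
    (hq : q ∈ Set.Ioo (0 : ℝ) 1) : μ.real (Set.Iic (quantile μ q)) = q := by
  refine le_antisymm ?_ ((quantile_le_iff μ hq _).1 le_rfl)
  rw [measureReal_congr (Iio_ae_eq_Iic (μ := μ)).symm]
  have hm : Monotone fun n : ℕ => Set.Iic (quantile μ q - 1 / ((n : ℝ) + 1)) := by
    intro m n hmn
    refine Set.Iic_subset_Iic.2 ?_
    have := Nat.one_div_le_one_div (α := ℝ) hmn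
    linarith
  have hU : Set.Iio (quantile μ q) = ⋃ n : ℕ, Set.Iic (quantile μ q - 1 / ((n : ℝ) + 1)) := by
    ext x
    simp only [Set.mem_Iio, Set.mem_iUnion, Set.mem_Iic]
    constructor
    · intro h
      obtain ⟨n, hn⟩ := exists_nat_one_div_lt (sub_pos.2 h)
      exact ⟨n, by linarith⟩
    · rintro ⟨n, hn⟩
      have : 0 < 1 / ((n : ℝ) + 1) := Nat.one_div_pos_of_nat
      linarith
  have ht := tendsto_measure_iUnion_atTop (μ := μ) hm
  rw [← hU] at ht
  have ht' := (ENNReal.tendsto_toReal (measure_ne_top μ _)).comp ht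
  refine le_of_tendsto ht' (Filter.Eventually.of_forall fun n => ?_)
  have hp : 0 < 1 / ((n : ℝ) + 1) := Nat.one_div_pos_of_nat
  by_contra! h
  have := (quantile_le_iff μ hq _).2 h.le
  linarith

instance : NullSingletonClass (gaussianReal 0 1) := nullSingletonClass_gaussianReal one_ne_zero

lemma gaussianReal_real_Ioi (c : ℝ) :
    (gaussianReal 0 1).real (Set.Ioi c) = (gaussianReal 0 1).real (Set.Iic (-c)) := by
  have h : (gaussianReal 0 1).map (fun x => -x) = gaussianReal 0 1 := by
    simp [gaussianReal_map_neg]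
  rw [measureReal_congr (Iio_ae_eq_Iic (μ := gaussianReal 0 1)).symm]
  conv_rhs => rw [← h]
  rw [map_measureReal_apply (by fun_prop) measurableSet_Iio]
  congr 1
  ext x
  simp

lemma gaussianReal_real_Iic_neg (c : ℝ) :
    (gaussianReal 0 1).real (Set.Iic (-c)) = 1 - (gaussianReal 0 1).real (Set.Iic c) := by
  rw [← gaussianReal_real_Ioi, ← Set.compl_Iic, probReal_compl_eq_one_sub measurableSet_Iic]

lemma real_Iic_zQuantile {q : ℝ} (hq : q ∈ Set.Ioo (0 : ℝ) 1) :
    (gaussianReal 0 1).real (Set.Iic (zQuantile q)) = q :=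
  real_Iic_quantile _ hq

lemma zQuantile_le_iff {q : ℝ} (hq : q ∈ Set.Ioo (0 : ℝ) 1) (x : ℝ) :
    zQuantile q ≤ x ↔ q ≤ (gaussianReal 0 1).real (Set.Iic x) :=
  quantile_le_iff _ hq x

lemma real_Iic_neg_zQuantile {α : ℝ} (hα : α ∈ Set.Ioo (0 : ℝ) 1) :
    (gaussianReal 0 1).real (Set.Iic (-zQuantile (1 - α))) = α := by
  rw [gaussianReal_real_Iic_neg, real_Iic_zQuantile ⟨by linarith [hα.2], by linarith [hα.1]⟩]
  ring

/-- This is where `q > α` enters: by symmetry `-z_{1-α}` has normal probability `α` below it.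
Positivity lets the null value `β - t` lie strictly below `β`. -/
lemma zQuantile_add_pos {α q : ℝ} (hα : α ∈ Set.Ioo (0 : ℝ) 1) (hq : q ∈ Set.Ioo α 1) :
    0 < zQuantile (1 - α) + zQuantile q := by
  by_contra! h
  have h1 := (zQuantile_le_iff ⟨hα.1.trans hq.1, hq.2⟩ (-zQuantile (1 - α))).1 (by linarith)
  rw [real_Iic_neg_zQuantile hα] at h1
  linarith [hq.1]

/-! ### Identification of laws and the Neyman–Pearson lemma. -/

/-- Moment generating functions that are finite everywhere determine the law. -/
lemma map_eq_of_mgf_eq {Ω₁ Ω₂ : Type*} [MeasurableSpace Ω₁] [MeasurableSpace Ω₂]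
    {μ : Measure Ω₁} {ν : Measure Ω₂} [IsProbabilityMeasure μ] [IsProbabilityMeasure ν]
    {X : Ω₁ → ℝ} {Y : Ω₂ → ℝ} (hX : AEMeasurable X μ) (hY : AEMeasurable Y ν)
    (hint : integrableExpSet X μ = Set.univ) (h : mgf X μ = mgf Y ν) :
    μ.map X = ν.map Y := by
  refine Measure.ext_of_complexMGF_eq hX hY ?_
  ext z
  exact eqOn_complexMGF_of_mgf h (by simp [hint])

/-- **Neyman–Pearson lemma** for an exponentially tilted alternative. -/
lemma neymanPearson_tilted {Ω : Type*} [MeasurableSpace Ω] {μ : Measure Ω} [IsProbabilityMeasure μ]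
    {f : Ω → ℝ} (hf : Measurable f) (hint : Integrable (fun x => Real.exp (f x)) μ) {c : ℝ}
    (hc : μ {x | f x = c} = 0) {A : Set Ω} (hA : MeasurableSet A)
    (hle : μ.real A ≤ μ.real {x | c < f x}) :
    (μ.tilted f).real A ≤ (μ.tilted f).real {x | c < f x} ∧
      ((μ.tilted f).real {x | c < f x} ≤ (μ.tilted f).real A → A =ᵐ[μ] {x | c < f x}) := by
  set B : Set Ω := {x | c < f x} with hB
  have hBm : MeasurableSet B := measurableSet_lt measurable_const hf
  set Z := ∫ x, Real.exp (f x) ∂μ with hZ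
  have hZpos : 0 < Z := integral_exp_pos hint
  set g : Ω → ℝ := fun x => Real.exp (f x) / Z with hg
  set κ : ℝ := Real.exp c / Z with hκ
  have hκ0 : 0 < κ := by positivity
  have hgint : Integrable g μ := hint.div_const _
  have htilt : ∀ s, MeasurableSet s → (μ.tilted f).real s = ∫ x, s.indicator g x ∂μ := by
    intro s hs
    rw [Measure.real, tilted_apply_eq_ofReal_integral' _ hs, integral_indicator hs,
      ENNReal.toReal_ofReal (integral_nonneg fun x => by positivity)]
  have hreal : ∀ s, MeasurableSet s → κ * μ.real s = ∫ x, s.indicator (fun _ => κ) x ∂μ := by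
    intro s hs
    rw [integral_indicator hs]
    simp [mul_comm]
  -- This is `(1_B - 1_A)(g - κ)`, nonnegative because `B` is where the density `g` exceeds `κ`. In
  -- the equality case its integral vanishes, so `A` and `B` agree off the null set `g = κ`.
  set h : Ω → ℝ := fun x => (B.indicator g x - A.indicator g x) -
    (B.indicator (fun _ => κ) x - A.indicator (fun _ => κ) x) with hh
  have hi1 : ∀ s, MeasurableSet s → Integrable (s.indicator g) μ := fun s hs => hgint.indicator hs
  have hi2 : ∀ s, MeasurableSet s → Integrable (s.indicator fun _ => κ) μ :=
    fun s hs => (integrable_const κ).indicator hs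
  have hhint : Integrable h μ :=
    ((hi1 B hBm).sub (hi1 A hA)).sub ((hi2 B hBm).sub (hi2 A hA))
  have hhval : ∫ x, h x ∂μ = ((μ.tilted f).real B - (μ.tilted f).real A)
      - (κ * μ.real B - κ * μ.real A) := by
    rw [htilt A hA, htilt B hBm, hreal A hA, hreal B hBm, ← integral_sub (hi1 B hBm) (hi1 A hA),
      ← integral_sub (hi2 B hBm) (hi2 A hA), ← integral_sub]
    · exact (hi1 B hBm).sub (hi1 A hA)
    · exact (hi2 B hBm).sub (hi2 A hA)
  have hgκ : ∀ x, (x ∈ B → κ < g x) ∧ (x ∉ B → g x ≤ κ) := by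
    intro x
    constructor
    · intro hx
      exact div_lt_div_of_pos_right (Real.exp_lt_exp.2 hx) hZpos
    · intro hx
      have : f x ≤ c := not_lt.1 hx
      exact div_le_div_of_nonneg_right (Real.exp_le_exp.2 this) hZpos.le
  have hh0 : 0 ≤ h := by
    intro x
    have := hgκ x
    by_cases hxB : x ∈ B <;> by_cases hxA : x ∈ A <;> simp [hh, hxA, hxB]
    · exact (this.1 hxB).le
    · exact this.2 hxB
  have hI := integral_nonneg (μ := μ) hh0
  have hκle : κ * μ.real A ≤ κ * μ.real B := mul_le_mul_of_nonneg_left hle hκ0.le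
  refine ⟨by linarith, fun hge => ?_⟩
  have hI0 : ∫ x, h x ∂μ = 0 := by linarith
  have hae := (integral_eq_zero_iff_of_nonneg hh0 hhint).1 hI0
  have hc' : ∀ᵐ x ∂μ, f x ≠ c := by
    rw [ae_iff]; simpa using hc
  filter_upwards [hae, hc'] with x hx hxc
  have hgx : g x ≠ κ := by
    intro h1
    have h2 : Real.exp (f x) = Real.exp c := by
      simpa [hg, hκ, div_left_inj' hZpos.ne'] using h1
    exact hxc (Real.exp_injective h2)
  have : (x ∈ A) = (x ∈ B) := by
    by_cases hxB : x ∈ B <;> by_cases hxA : x ∈ A <;> simp [hh, hxA, hxB] at hx ⊢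
    · exact hgx (by linarith)
    · exact hgx (by linarith)
  exact this

/-! ### Linear functionals and mean shifts of Gaussian laws. -/

section Gaussian

variable {ι : Type*} [Fintype ι] [DecidableEq ι] {S : Matrix ι ι ℝ}

lemma map_inner_multivariateGaussian (hS : S.PosSemidef) (μ x : EuclideanSpace ℝ ι) :
    (multivariateGaussian μ S).map (fun y => inner ℝ x y) =
      gaussianReal (inner ℝ x μ) (x ⬝ᵥ S *ᵥ x).toNNReal := by
  have h := IsGaussian.map_eq_gaussianReal (μ := multivariateGaussian μ S) (innerSL ℝ x)
  have h1 : (multivariateGaussian μ S)[innerSL ℝ x] = inner ℝ x μ := by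
    rw [(innerSL ℝ x).integral_comp_id_comm IsGaussian.integrable_id,
      integral_id_multivariateGaussian]
    rfl
  have h2 : Var[innerSL ℝ x; multivariateGaussian μ S] = x ⬝ᵥ S *ᵥ x := by
    rw [← covarianceBilin_multivariateGaussian (μ := μ) hS,
      covarianceBilin_self IsGaussian.memLp_two_id]
    rfl
  rw [h1, h2] at h
  exact h

lemma integral_exp_inner_multivariateGaussian (hS : S.PosSemidef) (μ x : EuclideanSpace ℝ ι) :
    ∫ y, Real.exp (inner ℝ x y) ∂(multivariateGaussian μ S) =
      Real.exp (inner ℝ x μ + x ⬝ᵥ S *ᵥ x / 2) := by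
  have h := mgf_gaussianReal (map_inner_multivariateGaussian hS μ x) 1
  have h0 : 0 ≤ x ⬝ᵥ S *ᵥ x := by simpa using hS.dotProduct_mulVec_nonneg x.ofLp
  simpa [mgf, Real.coe_toNNReal _ h0] using h

lemma integrable_exp_inner_multivariateGaussian (hS : S.PosSemidef) (μ x : EuclideanSpace ℝ ι) :
    Integrable (fun y => Real.exp (inner ℝ x y)) (multivariateGaussian μ S) := by
  -- A nonintegrable function has integral `0` by convention, but the integral just computed is
  -- positive.
  by_contra h
  have := integral_undef h
  rw [integral_exp_inner_multivariateGaussian hS] at this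
  exact (Real.exp_pos _).ne' this

/-- **Cameron–Martin**: tilting a Gaussian law by a linear functional shifts its mean. -/
lemma tilted_multivariateGaussian (hS : S.PosSemidef) (μ w : EuclideanSpace ℝ ι) :
    (multivariateGaussian μ S).tilted (fun y => inner ℝ w y) =
      multivariateGaussian (μ + toEuclideanCLM (𝕜 := ℝ) S w) S := by
  have : IsProbabilityMeasure ((multivariateGaussian μ S).tilted (fun y => inner ℝ w y)) :=
    isProbabilityMeasure_tilted (integrable_exp_inner_multivariateGaussian hS μ w)
  have hsymm : ∀ x : EuclideanSpace ℝ ι, w ⬝ᵥ S *ᵥ x = x ⬝ᵥ S *ᵥ w := by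
    intro x
    have hT : Sᵀ = S := by simpa using hS.isHermitian.eq
    rw [dotProduct_mulVec, ← mulVec_transpose, hT, dotProduct_comm]
  have hkey : ∀ x : EuclideanSpace ℝ ι,
      ∫ y, Real.exp (inner ℝ x y) ∂((multivariateGaussian μ S).tilted (fun y => inner ℝ w y)) =
      ∫ y, Real.exp (inner ℝ x y)
        ∂(multivariateGaussian (μ + toEuclideanCLM (𝕜 := ℝ) S w) S) := by
    intro x
    rw [integral_exp_tilted, integral_exp_inner_multivariateGaussian hS,
      integral_exp_inner_multivariateGaussian hS]
    have : ∀ y : EuclideanSpace ℝ ι, ((fun y => inner ℝ w y) + fun y => inner ℝ x y) y =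
        inner ℝ (w + x) y := fun y => by simp [inner_add_left]
    simp_rw [this]
    rw [integral_exp_inner_multivariateGaussian hS, ← Real.exp_sub]
    congr 1
    rw [inner_add_left, inner_add_right, inner_toEuclideanCLM]
    simp only [WithLp.ofLp_add, mulVec_add, add_dotProduct, dotProduct_add]
    rw [hsymm x]
    ring
  refine Measure.ext_of_charFun ?_
  ext x
  -- Reduction to one-dimensional projections, where the real moment generating function determines
  -- the law.
  have hmap : ∀ (ν : Measure (EuclideanSpace ℝ ι)),
      charFun ν x = charFun (ν.map fun y => inner ℝ x y) 1 := by
    intro ν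
    rw [charFun_apply, charFun_apply_real, integral_map (by fun_prop) (by fun_prop)]
    simp [real_inner_comm]
  rw [hmap, hmap]
  congr 1
  have hmgf : ∀ (ν : Measure (EuclideanSpace ℝ ι)) (t : ℝ),
      mgf (fun y => inner ℝ x y) ν t = ∫ y, Real.exp (inner ℝ (t • x) y) ∂ν := by
    intro ν t
    simp [mgf, inner_smul_left]
  refine (map_eq_of_mgf_eq (by fun_prop) (by fun_prop) ?_ ?_).symm
  · refine Set.eq_univ_of_forall fun t => ?_
    have := integrable_exp_inner_multivariateGaussian hS
      (μ + toEuclideanCLM (𝕜 := ℝ) S w) (t • x)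
    simpa [integrableExpSet, inner_smul_left] using this
  · ext t
    rw [hmgf, hmgf, hkey]

lemma real_lt_inner_multivariateGaussian (hS : S.PosSemidef) (μ a : EuclideanSpace ℝ ι) {σ : ℝ}
    (hσ : 0 < σ) (hvar : a ⬝ᵥ S *ᵥ a = σ ^ 2) (c : ℝ) :
    (multivariateGaussian μ S).real {y | c < inner ℝ a y} =
      (gaussianReal 0 1).real (Set.Iic ((inner ℝ a μ - c) / σ)) := by
  have hlaw : (multivariateGaussian μ S).map (fun y => inner ℝ a y) =
      (gaussianReal 0 1).map (fun x => inner ℝ a μ + σ * x) := by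
    have h1 := gaussianReal_map_const_mul (μ := 0) (v := 1) σ
    have h2 : (gaussianReal 0 1).map (fun x => inner ℝ a μ + σ * x) =
        ((gaussianReal 0 1).map (σ * ·)).map (inner ℝ a μ + ·) := by
      rw [Measure.map_map (by fun_prop) (by fun_prop)]
      rfl
    rw [h2, h1, gaussianReal_map_const_add, map_inner_multivariateGaussian hS, hvar]
    congr 1
    · simp
    · ext; simp [Real.coe_toNNReal _ (sq_nonneg σ)]
  have e1 : {y : EuclideanSpace ℝ ι | c < inner ℝ a y} =
      (fun y => inner ℝ a y) ⁻¹' Set.Ioi c := rfl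
  rw [e1, ← map_measureReal_apply (by fun_prop) measurableSet_Ioi, hlaw,
    map_measureReal_apply (by fun_prop) measurableSet_Ioi]
  have e2 : (fun x => inner ℝ a μ + σ * x) ⁻¹' Set.Ioi c = Set.Ioi (-((inner ℝ a μ - c) / σ)) := by
    ext x
    simp only [Set.mem_preimage, Set.mem_Ioi]
    rw [neg_lt, ← sub_pos, ← sub_pos (a := (inner ℝ a μ - c) / σ)]
    have : (inner ℝ a μ - c) / σ - -x = (inner ℝ a μ + σ * x - c) / σ := by field_simp; ring
    rw [this, div_pos_iff_of_pos_right hσ]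
  rw [e2, gaussianReal_real_Ioi, neg_neg]

lemma multivariateGaussian_inner_eq (hS : S.PosSemidef) (μ a : EuclideanSpace ℝ ι)
    (hvar : 0 < a ⬝ᵥ S *ᵥ a) (c : ℝ) :
    multivariateGaussian μ S {y | inner ℝ a y = c} = 0 := by
  have e1 : {y : EuclideanSpace ℝ ι | inner ℝ a y = c} = (fun y => inner ℝ a y) ⁻¹' {c} := rfl
  rw [e1, ← Measure.map_apply (by fun_prop) (measurableSet_singleton c),
    map_inner_multivariateGaussian hS]
  have := nullSingletonClass_gaussianReal (μ := inner ℝ a μ)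
    (v := (a ⬝ᵥ S *ᵥ a).toNNReal) (by simpa using hvar)
  exact measure_singleton c

lemma real_le_inner_multivariateGaussian (hS : S.PosSemidef) (μ a : EuclideanSpace ℝ ι) {σ : ℝ}
    (hσ : 0 < σ) (hvar : a ⬝ᵥ S *ᵥ a = σ ^ 2) (c : ℝ) :
    (multivariateGaussian μ S).real {y | c ≤ inner ℝ a y} =
      (gaussianReal 0 1).real (Set.Iic ((inner ℝ a μ - c) / σ)) := by
  rw [← real_lt_inner_multivariateGaussian hS μ a hσ hvar]
  refine measureReal_congr ?_
  have h0 := multivariateGaussian_inner_eq hS μ a (by rw [hvar]; positivity) c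
  have h1 : ∀ᵐ y ∂(multivariateGaussian μ S), inner ℝ a y ≠ c := by
    rw [ae_iff]; simpa using h0
  filter_upwards [h1] with y hy
  exact propext ⟨fun h => lt_of_le_of_ne h hy.symm, fun h => le_of_lt h⟩

/-- Gaussian laws with the same nonsingular covariance matrix are mutually absolutely continuous. -/
lemma multivariateGaussian_absolutelyContinuous (hS : S.PosDef) (μ ν : EuclideanSpace ℝ ι) :
    multivariateGaussian ν S ≪ multivariateGaussian μ S := by
  have h : toEuclideanCLM (𝕜 := ℝ) S (WithLp.toLp 2 (S⁻¹ *ᵥ (ν - μ).ofLp)) = ν - μ := by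
    rw [toEuclideanCLM_toLp, mulVec_mulVec, mul_nonsing_inv _ ((isUnit_iff_isUnit_det _).1 hS.isUnit),
      one_mulVec]
  have ht := tilted_multivariateGaussian hS.posSemidef μ (WithLp.toLp 2 (S⁻¹ *ᵥ (ν - μ).ofLp))
  rw [h, add_sub_cancel] at ht
  rw [← ht]
  exact tilted_absolutelyContinuous _ _

end Gaussian

/-! ### Optimality and uniqueness for intervals based on a linear statistic. -/

section OptimalCI

variable {k : ℕ}

/-- Lower end point `⟨a, y⟩ - z_{1-α} σ` of the interval based on the linear statistic `⟨a, y⟩`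
with standard deviation `σ`. -/
noncomputable def linearLB (α σ : ℝ) (a : EuclideanSpace ℝ (Fin (k + 1)))
    (y : EuclideanSpace ℝ (Fin (k + 1))) : ℝ :=
  inner ℝ a y - zQuantile (1 - α) * σ

lemma measurable_linearLB (α σ : ℝ) (a : EuclideanSpace ℝ (Fin (k + 1))) :
    Measurable (linearLB α σ a) := by
  unfold linearLB
  fun_prop

instance (Ω : Matrix (Fin (k + 1)) (Fin (k + 1)) ℝ) (β : ℝ) (δ : Fin k → ℝ) :
    IsProbabilityMeasure (limitLaw Ω β δ) := by
  unfold limitLaw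
  infer_instance

lemma inner_meanVector (a : EuclideanSpace ℝ (Fin (k + 1))) (β : ℝ) (δ : Fin k → ℝ) :
    inner ℝ a (meanVector β δ) = a 0 * β + ∑ i : Fin k, a i.succ * δ i := by
  simp [meanVector, PiLp.inner_apply, Fin.sum_univ_succ, mul_comm]

/-- The statistic `⟨a, y⟩` never overestimates `β` on average when `δ ≥ 0`, and `σ²` is both its
variance and its covariance with `Y_β`. -/
structure IsDominatedStatistic (Ω : Matrix (Fin (k + 1)) (Fin (k + 1)) ℝ)
    (a : EuclideanSpace ℝ (Fin (k + 1))) (σ : ℝ) : Prop where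
  zero_eq : a 0 = 1
  succ_nonpos : ∀ i : Fin k, a i.succ ≤ 0
  pos : 0 < σ
  variance : a ⬝ᵥ Ω *ᵥ a = σ ^ 2
  cov_zero : (Ω *ᵥ a) 0 = σ ^ 2

namespace IsDominatedStatistic

variable {Ω : Matrix (Fin (k + 1)) (Fin (k + 1)) ℝ} {a : EuclideanSpace ℝ (Fin (k + 1))} {σ α : ℝ}

lemma isUpperCI (h : IsDominatedStatistic Ω a σ) (hΩ : Ω.PosDef) (hα : α ∈ Set.Ioo (0 : ℝ) 1) :
    IsUpperCI Ω α (linearLB α σ a) := by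
  refine ⟨measurable_linearLB α σ a, fun p hp => ?_⟩
  have hset : {y : EuclideanSpace ℝ (Fin (k + 1)) | p.1 ∈ Set.Ici (linearLB α σ a y)} =
      {y | p.1 + zQuantile (1 - α) * σ < inner ℝ a y}ᶜ := by
    ext y
    simp [linearLB]
  have hz := real_Iic_neg_zQuantile hα
  have hmean : inner ℝ a (meanVector p.1 p.2) ≤ p.1 := by
    rw [inner_meanVector, h.zero_eq, one_mul]
    have := Finset.sum_nonpos (s := Finset.univ) fun i (_ : i ∈ Finset.univ) =>
      mul_nonpos_of_nonpos_of_nonneg (h.succ_nonpos i) (hp i)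
    linarith
  rw [hset, probReal_compl_eq_one_sub (measurableSet_lt (by fun_prop) (by fun_prop)), limitLaw,
    real_lt_inner_multivariateGaussian hΩ.posSemidef _ _ h.pos h.variance]
  have hle : (inner ℝ a (meanVector p.1 p.2) - (p.1 + zQuantile (1 - α) * σ)) / σ ≤
      -zQuantile (1 - α) := by
    rw [div_le_iff₀ h.pos]
    linarith
  have := measureReal_mono (μ := gaussianReal 0 1) (Set.Iic_subset_Iic.2 hle)
  linarith

/-- When `⟨a, Y⟩` is unbiased, `β - lb(Y)` is normal with mean `σ z_{1-α}` and standard deviation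
`σ`. -/
lemma excessQuantile_eq (h : IsDominatedStatistic Ω a σ) (hΩ : Ω.PosDef) {q : ℝ}
    (hq : q ∈ Set.Ioo (0 : ℝ) 1) {β : ℝ} {δ : Fin k → ℝ} (hmean : inner ℝ a (meanVector β δ) = β) :
    excessQuantile Ω (linearLB α σ a) q β δ = σ * (zQuantile (1 - α) + zQuantile q) := by
  have hm : Measurable fun y => β - linearLB α σ a y :=
    measurable_const.sub (measurable_linearLB α σ a)
  have hset : {x : ℝ | q ≤ ((limitLaw Ω β δ).map fun y => β - linearLB α σ a y).real
      (Set.Iic x)} = Set.Ici (σ * (zQuantile (1 - α) + zQuantile q)) := by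
    ext x
    rw [Set.mem_ofPred_eq, map_measureReal_apply hm measurableSet_Iic]
    have hs : (fun y => β - linearLB α σ a y) ⁻¹' Set.Iic x =
        {y | β + zQuantile (1 - α) * σ - x ≤ inner ℝ a y} := by
      ext y
      simp only [linearLB, Set.mem_preimage, Set.mem_Iic, Set.mem_ofPred_eq]
      constructor <;> intro _ <;> linarith
    rw [hs, limitLaw, real_le_inner_multivariateGaussian hΩ.posSemidef _ _ h.pos h.variance,
      ← zQuantile_le_iff hq, hmean, Set.mem_Ici, le_div_iff₀ h.pos]
    constructor <;> intro _ <;> linarith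
  rw [excessQuantile, quantile, hset, csInf_Ici]

/-- Power bound: under the alternative `(β, δ)`, no valid interval excludes `β - t` with larger
probability than the one based on `⟨a, y⟩`, because the point obtained by moving from `(β, δ)`
along `-Ωa` is in the parameter space. -/
lemma power_le (h : IsDominatedStatistic Ω a σ) (hΩ : Ω.PosDef) (hα : α ∈ Set.Ioo (0 : ℝ) 1)
    {lb : EuclideanSpace ℝ (Fin (k + 1)) → ℝ} (hlb : IsUpperCI Ω α lb) {β t : ℝ} {δ : Fin k → ℝ}
    (hmean : inner ℝ a (meanVector β δ) = β) (ht : 0 < t)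
    (hδ : ∀ i : Fin k, t / σ ^ 2 * (Ω *ᵥ a) i.succ ≤ δ i) :
    (limitLaw Ω β δ).real {y | β - t < lb y} ≤
        (gaussianReal 0 1).real (Set.Iic (t / σ - zQuantile (1 - α))) ∧
      ((gaussianReal 0 1).real (Set.Iic (t / σ - zQuantile (1 - α))) ≤
          (limitLaw Ω β δ).real {y | β - t < lb y} →
        {y | β - t < lb y} =ᵐ[limitLaw Ω β δ] {y | β - t < linearLB α σ a y}) := by
  have hσ := h.pos
  -- Since `(Ωa)₀ = σ²`, moving by `τ Ωa` changes the `β` coordinate by exactly `t`.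
  set τ : ℝ := t / σ ^ 2 with hτ
  have hτ0 : 0 < τ := by positivity
  set δ₀ : Fin k → ℝ := fun i => δ i - τ * (Ω *ᵥ a) i.succ with hδ₀
  set P₀ := limitLaw Ω (β - t) δ₀ with hP₀
  have hvec : meanVector (β - t) δ₀ + toEuclideanCLM (𝕜 := ℝ) Ω (τ • a) = meanVector β δ := by
    ext i
    have hi : (toEuclideanCLM (𝕜 := ℝ) Ω (τ • a)) i = τ * (Ω *ᵥ a) i := by
      rw [map_smul, PiLp.smul_apply, ofLp_toEuclideanCLM, smul_eq_mul]
    rw [PiLp.add_apply, hi]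
    refine Fin.cases ?_ (fun j => ?_) i
    · rw [h.cov_zero]
      simp only [meanVector, Fin.cons_zero]
      rw [hτ]; field_simp; ring
    · simp [meanVector, hδ₀]
  have htilt : P₀.tilted (fun y => inner ℝ (τ • a) y) = limitLaw Ω β δ := by
    rw [hP₀, limitLaw, tilted_multivariateGaussian hΩ.posSemidef, hvec, limitLaw]
  have hmean₀ : inner ℝ a (meanVector (β - t) δ₀) = β - t := by
    have := congrArg (fun v => inner ℝ a v) hvec
    simp only [inner_add_right, inner_toEuclideanCLM, WithLp.ofLp_smul, mulVec_smul,
      dotProduct_smul, h.variance, hmean, smul_eq_mul] at this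
    have e : τ * σ ^ 2 = t := by rw [hτ]; field_simp
    linarith
  set c : ℝ := β - t + zQuantile (1 - α) * σ with hc
  have hB : ∀ y : EuclideanSpace ℝ (Fin (k + 1)),
      τ * c < inner ℝ (τ • a) y ↔ c < inner ℝ a y := by
    intro y
    rw [inner_smul_left]
    simp [mul_lt_mul_iff_right₀ hτ0]
  have hBset : {y : EuclideanSpace ℝ (Fin (k + 1)) | τ * c < inner ℝ (τ • a) y} =
      {y | c < inner ℝ a y} := by
    ext y; exact hB y
  have hBset' : {y : EuclideanSpace ℝ (Fin (k + 1)) | c < inner ℝ a y} =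
      {y | β - t < linearLB α σ a y} := by
    ext y
    simp only [linearLB, Set.mem_ofPred_eq, hc]
    constructor <;> intro _ <;> linarith
  have hBP : P₀.real {y | c < inner ℝ a y} = α := by
    rw [hP₀, limitLaw, real_lt_inner_multivariateGaussian hΩ.posSemidef _ _ hσ h.variance, hmean₀,
      ← real_Iic_neg_zQuantile hα]
    congr 2
    rw [hc]; field_simp; ring
  have hAm : MeasurableSet {y | β - t < lb y} := measurableSet_lt measurable_const hlb.1
  have hA : P₀.real {y | β - t < lb y} ≤ α := by
    have h1 := hlb.2 (β - t, δ₀) (fun i => sub_nonneg.2 (hδ i))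
    have h2 : {y | (β - t, δ₀).1 ∈ Set.Ici (lb y)} = {y | β - t < lb y}ᶜ := by
      ext y; simp
    rw [h2, probReal_compl_eq_one_sub hAm] at h1
    linarith
  have hnull : P₀ {y | inner ℝ (τ • a) y = τ * c} = 0 := by
    have h1 := multivariateGaussian_inner_eq hΩ.posSemidef (meanVector (β - t) δ₀) a
      (by rw [h.variance]; positivity) c
    have h2 : {y : EuclideanSpace ℝ (Fin (k + 1)) | inner ℝ (τ • a) y = τ * c} =
        {y | inner ℝ a y = c} := by
      ext y
      rw [Set.mem_ofPred_eq, inner_smul_left]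
      simp [hτ0.ne']
    rw [h2]
    exact h1
  have hNP := neymanPearson_tilted (μ := P₀) (f := fun y => inner ℝ (τ • a) y) (by fun_prop)
    (integrable_exp_inner_multivariateGaussian hΩ.posSemidef _ _) hnull hAm
    (by rw [hBset, hBP]; exact hA)
  have hpow : (limitLaw Ω β δ).real {y | c < inner ℝ a y} =
      (gaussianReal 0 1).real (Set.Iic (t / σ - zQuantile (1 - α))) := by
    rw [limitLaw, real_lt_inner_multivariateGaussian hΩ.posSemidef _ _ hσ h.variance, hmean]
    congr 2
    rw [hc]; field_simp; ring
  rw [htilt, hBset, hpow, hBset'] at hNP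
  refine ⟨hNP.1, fun hge => ?_⟩
  exact (multivariateGaussian_absolutelyContinuous hΩ _ _).ae_le (hNP.2 hge)

/-- Lower bound for the maximal excess length quantile of any valid interval. -/
lemma le_maxExcessQuantile (h : IsDominatedStatistic Ω a σ) (hΩ : Ω.PosDef)
    (hα : α ∈ Set.Ioo (0 : ℝ) 1) {lb : EuclideanSpace ℝ (Fin (k + 1)) → ℝ}
    (hlb : IsUpperCI Ω α lb) {G : Set (ℝ × (Fin k → ℝ))} {β : ℝ}
    (hG : ∀ t : ℝ, 0 < t → ∃ δ : Fin k → ℝ, (β, δ) ∈ G ∧ inner ℝ a (meanVector β δ) = β ∧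
      ∀ i : Fin k, t / σ ^ 2 * (Ω *ᵥ a) i.succ ≤ δ i)
    {q : ℝ} (hq : q ∈ Set.Ioo α 1) :
    ((σ * (zQuantile (1 - α) + zQuantile q) : ℝ) : EReal) ≤ maxExcessQuantile Ω lb q G := by
  by_contra! hlt
  have hq' : q ∈ Set.Ioo (0 : ℝ) 1 := ⟨hα.1.trans hq.1, hq.2⟩
  have hpos : 0 < σ * (zQuantile (1 - α) + zQuantile q) := mul_pos h.pos (zQuantile_add_pos hα hq)
  -- The maximum with `0` forces `t > 0`, as the power bound requires.
  obtain ⟨t, ht1, ht2⟩ := EReal.lt_iff_exists_real_btwn.1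
    (max_lt hlt (EReal.coe_lt_coe_iff.2 hpos))
  have ht0 : 0 < t := by
    have := (le_max_right _ _).trans_lt ht1
    exact_mod_cast this
  have hmax := (le_max_left _ _).trans_lt ht1
  have ht2 : t < σ * (zQuantile (1 - α) + zQuantile q) := by exact_mod_cast ht2
  obtain ⟨δ, hδG, hmean, hδ⟩ := hG t ht0
  have hex : excessQuantile Ω lb q β δ < t := by
    have h1 : ((excessQuantile Ω lb q β δ : ℝ) : EReal) ≤ maxExcessQuantile Ω lb q G :=
      le_iSup₂_of_le (β, δ) hδG le_rfl
    exact_mod_cast h1.trans_lt hmax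
  have hm : Measurable fun y => β - lb y := measurable_const.sub hlb.1
  have : IsProbabilityMeasure ((limitLaw Ω β δ).map fun y => β - lb y) :=
    Measure.isProbabilityMeasure_map hm.aemeasurable
  have hqle := (quantile_le_iff ((limitLaw Ω β δ).map fun y => β - lb y) hq'
    (excessQuantile Ω lb q β δ)).1 le_rfl
  rw [map_measureReal_apply hm measurableSet_Iic] at hqle
  have hsub : (fun y => β - lb y) ⁻¹' Set.Iic (excessQuantile Ω lb q β δ) ⊆
      {y | β - t < lb y} := by
    intro y hy
    have : β - lb y ≤ excessQuantile Ω lb q β δ := hy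
    show β - t < lb y
    linarith
  have h1 := (hqle.trans (measureReal_mono hsub)).trans
    (h.power_le hΩ hα hlb hmean ht0 hδ).1
  rw [← zQuantile_le_iff hq', le_sub_iff_add_le, le_div_iff₀ h.pos] at h1
  linarith

lemma maxExcessQuantile_le (h : IsDominatedStatistic Ω a σ) (hΩ : Ω.PosDef)
    {G : Set (ℝ × (Fin k → ℝ))} (hmean : ∀ p ∈ G, inner ℝ a (meanVector p.1 p.2) = p.1)
    {q : ℝ} (hq : q ∈ Set.Ioo (0 : ℝ) 1) :
    maxExcessQuantile Ω (linearLB α σ a) q G ≤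
      ((σ * (zQuantile (1 - α) + zQuantile q) : ℝ) : EReal) :=
  iSup₂_le fun p hp => by rw [h.excessQuantile_eq hΩ hq (hmean p hp)]

/-- On `G` the linear interval has constant excess quantile, and the matching lower bound needs
admissible alternatives at a single `β` only. Hence the same statement serves the joint and the
fixed-`β` criteria. -/
theorem isOptimalCI (h : IsDominatedStatistic Ω a σ) (hΩ : Ω.PosDef)
    (hα : α ∈ Set.Ioo (0 : ℝ) 1) {G : Set (ℝ × (Fin k → ℝ))}
    (hmean : ∀ p ∈ G, inner ℝ a (meanVector p.1 p.2) = p.1) (β : ℝ)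
    (hG : ∀ t : ℝ, 0 < t → ∃ δ : Fin k → ℝ, (β, δ) ∈ G ∧
      ∀ i : Fin k, t / σ ^ 2 * (Ω *ᵥ a) i.succ ≤ δ i) :
    IsOptimalCI Ω α G (linearLB α σ a) := by
  refine ⟨h.isUpperCI hΩ hα, fun lb hlb q hq => ?_⟩
  refine (h.maxExcessQuantile_le hΩ hmean ⟨hα.1.trans hq.1, hq.2⟩).trans
    (h.le_maxExcessQuantile hΩ hα hlb (β := β) (fun t ht => ?_) hq)
  obtain ⟨δ, hδ, hδ'⟩ := hG t ht
  exact ⟨δ, hδ, hmean _ hδ, hδ'⟩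

/-- One level `q` suffices, because every threshold `b` can be tested from the alternative `β = b +
t`. Mutual absolute continuity transfers the conclusions to a common law. -/
theorem ae_eq_of_isOptimalCI (h : IsDominatedStatistic Ω a σ) (hΩ : Ω.PosDef)
    (hα : α ∈ Set.Ioo (0 : ℝ) 1) {G : Set (ℝ × (Fin k → ℝ))}
    (hmean : ∀ p ∈ G, inner ℝ a (meanVector p.1 p.2) = p.1)
    (hG : ∀ β t : ℝ, 0 < t → ∃ δ : Fin k → ℝ, (β, δ) ∈ G ∧
      ∀ i : Fin k, t / σ ^ 2 * (Ω *ᵥ a) i.succ ≤ δ i)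
    {lb : EuclideanSpace ℝ (Fin (k + 1)) → ℝ} (hlb : IsOptimalCI Ω α G lb)
    (p : ℝ × (Fin k → ℝ)) : lb =ᵐ[limitLaw Ω p.1 p.2] linearLB α σ a := by
  obtain ⟨q, hq⟩ : (Set.Ioo α 1).Nonempty := Set.nonempty_Ioo.2 hα.2
  have hq' : q ∈ Set.Ioo (0 : ℝ) 1 := ⟨hα.1.trans hq.1, hq.2⟩
  set t := σ * (zQuantile (1 - α) + zQuantile q) with ht
  have ht0 : 0 < t := mul_pos h.pos (zQuantile_add_pos hα hq)
  set P := limitLaw Ω p.1 p.2 with hP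
  -- The quantile controls `b ≤ lb y` and the power bound `b < lb y`; these agree almost surely
  -- unless `b` is one of the countably many atoms of `lb`.
  set N : Set ℝ := {b | 0 < P {y | lb y = b}} with hN
  have hNc : N.Countable := Measure.countable_meas_level_set_pos hlb.1.1
  have hkey : ∀ b ∉ N, ∀ᵐ y ∂P, b < lb y ↔ b < linearLB α σ a y := by
    intro b hb
    have hb0 : P {y | lb y = b} = 0 := by simpa [hN] using hb
    obtain ⟨δ, hδG, hδ⟩ := hG (b + t) t ht0
    have hac := multivariateGaussian_absolutelyContinuous hΩ (meanVector p.1 p.2)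
      (meanVector (b + t) δ)
    have hac' := multivariateGaussian_absolutelyContinuous hΩ (meanVector (b + t) δ)
      (meanVector p.1 p.2)
    have hex : excessQuantile Ω lb q (b + t) δ ≤ t := by
      have h1 : ((excessQuantile Ω lb q (b + t) δ : ℝ) : EReal) ≤ maxExcessQuantile Ω lb q G :=
        le_iSup₂_of_le (b + t, δ) hδG le_rfl
      have h2 := (h1.trans (hlb.2 _ (h.isUpperCI hΩ hα) q hq)).trans
        (h.maxExcessQuantile_le hΩ hmean hq')
      exact_mod_cast h2
    have hm : Measurable fun y => b + t - lb y := measurable_const.sub hlb.1.1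
    have : IsProbabilityMeasure ((limitLaw Ω (b + t) δ).map fun y => b + t - lb y) :=
      Measure.isProbabilityMeasure_map hm.aemeasurable
    have hqle := (quantile_le_iff ((limitLaw Ω (b + t) δ).map fun y => b + t - lb y) hq' t).1 hex
    rw [map_measureReal_apply hm measurableSet_Iic] at hqle
    have hae : (fun y => b + t - lb y) ⁻¹' Set.Iic t =ᵐ[limitLaw Ω (b + t) δ]
        {y | b + t - t < lb y} := by
      have hne : ∀ᵐ y ∂(limitLaw Ω (b + t) δ), lb y ≠ b := by
        rw [ae_iff]
        simpa [limitLaw] using hac hb0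
      filter_upwards [hne] with y hy
      refine propext ⟨fun (h1 : b + t - lb y ≤ t) => ?_, fun (h1 : b + t - t < lb y) => ?_⟩
      · have h2 : b < lb y := lt_of_le_of_ne (by linarith) hy.symm
        show b + t - t < lb y
        linarith
      · show b + t - lb y ≤ t
        linarith
    rw [measureReal_congr hae] at hqle
    have hpow := (h.power_le hΩ hα hlb.1 (hmean _ hδG) ht0 hδ).2 ?_
    · have h1 := hac'.ae_le hpow
      filter_upwards [h1] with y hy
      have hy' : (b + t - t < lb y) = (b + t - t < linearLB α σ a y) := hy
      rw [add_sub_cancel_right] at hy'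
      rw [hy']
    -- The choice of `t` makes the power bound equal to `q`, so the Neyman–Pearson inequality is an
    -- equality.
    · have e : t / σ - zQuantile (1 - α) = zQuantile q := by
        rw [ht]; field_simp [h.pos.ne']; ring
      rw [e, real_Iic_zQuantile hq']
      exact hqle
  obtain ⟨D, hDc, hDd, hDN⟩ : ∃ D : Set ℝ, D.Countable ∧ Dense D ∧ D ⊆ Nᶜ := by
    obtain ⟨D, hDs, hDc, hDd⟩ := (hNc.dense_compl ℝ).exists_countable_dense_subset
    exact ⟨D, hDc, hDd, hDs⟩
  have hall : ∀ᵐ y ∂P, ∀ b ∈ D, b < lb y ↔ b < linearLB α σ a y :=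
    (ae_ball_iff hDc).2 fun b hb => hkey b (hDN hb)
  filter_upwards [hall] with y hy
  by_contra hne
  rcases lt_or_gt_of_ne hne with hlt | hlt
  · obtain ⟨b, hb, h1, h2⟩ := hDd.exists_between hlt
    exact lt_asymm h1 ((hy b hb).2 h2)
  · obtain ⟨b, hb, h1, h2⟩ := hDd.exists_between hlt
    exact lt_asymm h1 ((hy b hb).1 h2)

end IsDominatedStatistic

end OptimalCI

/-! ### Quadratic minimization over the nonnegative orthant. -/

section Quadratic

variable {ι : Type*} [Fintype ι] {M : Matrix ι ι ℝ}

/-- A positive definite quadratic function attains its minimum on the nonnegative orthant. -/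
lemma exists_isMinOn_nonneg_quadratic (hM : M.PosDef) (c : ι → ℝ) :
    ∃ w : ι → ℝ, 0 ≤ w ∧ ∀ v : ι → ℝ, 0 ≤ v →
      w ⬝ᵥ M *ᵥ w - 2 * (w ⬝ᵥ c) ≤ v ⬝ᵥ M *ᵥ v - 2 * (v ⬝ᵥ c) := by
  classical
  obtain ⟨m, hm0, hm⟩ : ∃ m : ℝ, 0 < m ∧ ∀ v : ι → ℝ, m * ‖v‖ ^ 2 ≤ v ⬝ᵥ M *ᵥ v := by
    have hcont : Continuous fun v : ι → ℝ => v ⬝ᵥ M *ᵥ v := by fun_prop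
    rcases (Metric.sphere (0 : ι → ℝ) 1).eq_empty_or_nonempty with he | hne
    -- An empty unit sphere means the space is trivial.
    · refine ⟨1, one_pos, fun v => ?_⟩
      have hv : v = 0 := by
        by_contra hv
        have : ‖v‖⁻¹ • v ∈ Metric.sphere (0 : ι → ℝ) 1 := by
          simp [norm_smul, hv]
        simp [he] at this
      simp [hv]
    · obtain ⟨u, hu, hmin⟩ := (isCompact_sphere (0 : ι → ℝ) 1).exists_isMinOn hne
        hcont.continuousOn
      have hu0 : u ≠ 0 := by
        rintro rfl
        simp at hu
      refine ⟨u ⬝ᵥ M *ᵥ u, by simpa using hM.dotProduct_mulVec_pos hu0, fun v => ?_⟩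
      by_cases hv : v = 0
      · simp [hv]
      · have hv' : 0 < ‖v‖ := norm_pos_iff.2 hv
        have h1 := hmin (show ‖v‖⁻¹ • v ∈ Metric.sphere (0 : ι → ℝ) 1 by simp [norm_smul, hv])
        simp only [Set.mem_ofPred_eq, mulVec_smul, dotProduct_smul, smul_dotProduct,
          smul_eq_mul] at h1
        calc _ ≤ (‖v‖⁻¹ * (‖v‖⁻¹ * (v ⬝ᵥ M *ᵥ v))) * ‖v‖ ^ 2 :=
              mul_le_mul_of_nonneg_right h1 (by positivity)
          _ = _ := by field_simp
  set C : ℝ := ∑ i, |c i| with hC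
  have hC0 : 0 ≤ C := Finset.sum_nonneg fun i _ => abs_nonneg _
  have hlin : ∀ v : ι → ℝ, v ⬝ᵥ c ≤ ‖v‖ * C := by
    intro v
    rw [dotProduct, hC, Finset.mul_sum]
    refine Finset.sum_le_sum fun i _ => (le_abs_self _).trans ?_
    rw [abs_mul]
    exact mul_le_mul_of_nonneg_right (norm_le_pi_norm v i) (abs_nonneg _)
  -- Beyond norm `R` the bound `m‖v‖² - 2C‖v‖` is nonnegative, so the objective is no smaller than
  -- its value at `0`.
  set R : ℝ := 2 * C / m with hR
  have hR0 : 0 ≤ R := by positivity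
  obtain ⟨w, hw, hmin⟩ := (isCompact_Icc (a := (0 : ι → ℝ)) (b := fun _ => R)).exists_isMinOn
    ⟨0, le_rfl, fun _ => hR0⟩
    (f := fun v : ι → ℝ => v ⬝ᵥ M *ᵥ v - 2 * (v ⬝ᵥ c)) (by fun_prop)
  refine ⟨w, hw.1, fun v hv => ?_⟩
  by_cases hvR : v ∈ Set.Icc (0 : ι → ℝ) fun _ => R
  · exact hmin hvR
  · have h0 := hmin (show (0 : ι → ℝ) ∈ Set.Icc (0 : ι → ℝ) fun _ => R from
      ⟨le_rfl, fun _ => hR0⟩)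
    simp only [Set.mem_ofPred_eq, zero_dotProduct, mul_zero, sub_zero] at h0
    have hnorm : R < ‖v‖ := by
      by_contra! hle
      exact hvR ⟨hv, fun i => (le_abs_self _).trans ((norm_le_pi_norm v i).trans hle)⟩
    have h1 : 2 * C ≤ m * ‖v‖ := by
      rw [hR, div_lt_iff₀ hm0] at hnorm
      linarith
    have h2 : 0 ≤ ‖v‖ * (m * ‖v‖ - 2 * C) := mul_nonneg (norm_nonneg v) (by linarith)
    have := hm v
    have := hlin v
    nlinarith

lemma quadratic_add_smul_single [DecidableEq ι] (hM : M.IsHermitian) (c w : ι → ℝ) (i : ι)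
    (ε : ℝ) :
    (w + ε • Pi.single i 1) ⬝ᵥ M *ᵥ (w + ε • Pi.single i 1) -
        2 * ((w + ε • Pi.single i 1) ⬝ᵥ c) =
      w ⬝ᵥ M *ᵥ w - 2 * (w ⬝ᵥ c) + ε * (2 * ((M *ᵥ w) i - c i) + ε * M i i) := by
  have hT : Mᵀ = M := by simpa using hM.eq
  have h1 : w ⬝ᵥ M *ᵥ Pi.single i 1 = (M *ᵥ w) i := by
    rw [dotProduct_mulVec, ← mulVec_transpose, hT, dotProduct_single_one]
  simp only [mulVec_add, mulVec_smul, add_dotProduct, dotProduct_add, smul_dotProduct,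
    dotProduct_smul, single_one_dotProduct, h1, smul_eq_mul]
  have h2 : (M *ᵥ Pi.single i 1) i = M i i := by simp
  rw [h2]
  ring

lemma nonneg_of_forall_nonneg_add_mul {g d η : ℝ} (hη : 0 < η)
    (h : ∀ ε, 0 < ε → ε ≤ η → 0 ≤ g + ε * d) : 0 ≤ g := by
  have ht : Filter.Tendsto (fun ε : ℝ => g + ε * d) (nhdsWithin 0 (Set.Ioi 0)) (nhds g) := by
    have : Filter.Tendsto (fun ε : ℝ => g + ε * d) (nhds 0) (nhds (g + 0 * d)) :=
      Continuous.tendsto (by fun_prop) 0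
    simpa using this.mono_left nhdsWithin_le_nhds
  refine ge_of_tendsto ht ?_
  filter_upwards [Ioc_mem_nhdsGT hη] with ε hε
  exact h ε hε.1 hε.2

/-- First-order conditions at a minimum of a quadratic function on the nonnegative orthant. -/
lemma kkt_of_isMinOn_nonneg_quadratic (hM : M.IsHermitian) {c w : ι → ℝ} (hw : 0 ≤ w)
    (hmin : ∀ v : ι → ℝ, 0 ≤ v →
      w ⬝ᵥ M *ᵥ w - 2 * (w ⬝ᵥ c) ≤ v ⬝ᵥ M *ᵥ v - 2 * (v ⬝ᵥ c)) (i : ι) :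
    c i ≤ (M *ᵥ w) i ∧ (0 < w i → (M *ᵥ w) i = c i) := by
  classical
  have hle : c i ≤ (M *ᵥ w) i := by
    have := nonneg_of_forall_nonneg_add_mul (g := 2 * ((M *ᵥ w) i - c i)) (d := M i i) one_pos
      fun ε hε _ => by
        have h1 := hmin (w + ε • Pi.single i 1) (add_nonneg hw (smul_nonneg hε.le
          (Pi.single_nonneg.2 zero_le_one)))
        rw [quadratic_add_smul_single hM] at h1
        exact nonneg_of_mul_nonneg_right (by linarith) hε
    linarith
  refine ⟨hle, fun hi => le_antisymm ?_ hle⟩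
  -- Decreasing coordinate `i` stays in the orthant for steps up to `w i`.
  have := nonneg_of_forall_nonneg_add_mul (g := -(2 * ((M *ᵥ w) i - c i))) (d := M i i) hi
    fun ε hε hεi => by
      have h0 : 0 ≤ w + (-ε) • Pi.single i 1 := by
        intro j
        by_cases hj : j = i
        · subst hj; simpa using hεi
        · simpa [hj] using hw j
      have h1 := hmin _ h0
      rw [quadratic_add_smul_single hM] at h1
      exact nonneg_of_mul_nonneg_right (a := ε) (by linarith) hε
  linarith

end Quadratic

/-! ### Regression on subvectors and the residual statistic. -/

section Subvector

variable {k : ℕ} {Ω : Matrix (Fin (k + 1)) (Fin (k + 1)) ℝ}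

/-- The regression coefficients of `δ(s)`, extended by zero to all of `δ`. -/
noncomputable def extendCoef (Ω : Matrix (Fin (k + 1)) (Fin (k + 1)) ℝ) (s : Finset (Fin k)) :
    Fin k → ℝ :=
  fun i => if h : i ∈ s then regCoef Ω s ⟨i, h⟩ else 0

lemma sum_mul_extend (s : Finset (Fin k)) (v : s → ℝ) (f : Fin k → ℝ) :
    ∑ i, f i * (if h : i ∈ s then v ⟨i, h⟩ else 0) = ∑ i : s, f i * v i := by
  rw [← Finset.sum_subset (Finset.subset_univ s) (fun i _ hi => by simp [hi]),
    ← Finset.sum_coe_sort s]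
  exact Finset.sum_congr rfl fun i _ => by simp

/-- The block `Ω_{δδ}`. -/
def nuisanceCov (Ω : Matrix (Fin (k + 1)) (Fin (k + 1)) ℝ) : Matrix (Fin k) (Fin k) ℝ :=
  Ω.submatrix Fin.succ Fin.succ

lemma nuisanceCov_posDef (hΩ : Ω.PosDef) : (nuisanceCov Ω).PosDef :=
  hΩ.submatrix (Fin.succ_injective k)

lemma subCov_posDef (hΩ : Ω.PosDef) (s : Finset (Fin k)) : (subCov Ω s).PosDef :=
  hΩ.submatrix ((Fin.succ_injective k).comp Subtype.val_injective)

lemma posDef_apply_comm (hΩ : Ω.PosDef) (i j : Fin (k + 1)) : Ω i j = Ω j i := by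
  simpa using hΩ.isHermitian.apply j i

/-- The normal equations determine the coefficients, so the positive part of a minimizer can be
recognized as a regression vector. -/
lemma eq_regCoef_iff (hΩ : Ω.PosDef) (s : Finset (Fin k)) (v : s → ℝ) :
    v = regCoef Ω s ↔ ∀ i : s, (subCov Ω s *ᵥ v) i = Ω (i : Fin k).succ 0 := by
  have hdet := (isUnit_iff_isUnit_det _).1 (subCov_posDef hΩ s).isUnit
  have hT : (subCov Ω s)ᵀ = subCov Ω s := by simpa using (subCov_posDef hΩ s).isHermitian.eq
  have hc : crossCov Ω s = fun i : s => Ω (i : Fin k).succ 0 := by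
    ext i
    exact posDef_apply_comm hΩ _ _
  have hr : regCoef Ω s = (subCov Ω s)⁻¹ *ᵥ crossCov Ω s := by
    rw [regCoef, ← mulVec_transpose, transpose_nonsing_inv, hT]
  constructor
  · rintro rfl i
    rw [hr, mulVec_mulVec, mul_nonsing_inv _ hdet, one_mulVec, hc]
  · intro h
    have h' : subCov Ω s *ᵥ v = crossCov Ω s := by rw [hc]; exact funext h
    rw [hr, ← h', mulVec_mulVec, nonsing_inv_mul _ hdet, one_mulVec]

lemma nuisanceCov_mulVec_extendCoef (hΩ : Ω.PosDef) {s : Finset (Fin k)} {i : Fin k}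
    (hi : i ∈ s) : (nuisanceCov Ω *ᵥ extendCoef Ω s) i = Ω i.succ 0 := by
  rw [← (eq_regCoef_iff hΩ s _).1 rfl ⟨i, hi⟩]
  exact sum_mul_extend s _ _

lemma dotProduct_extendCoef (s : Finset (Fin k)) (f : Fin k → ℝ) :
    f ⬝ᵥ extendCoef Ω s = ∑ i : s, f i * regCoef Ω s i :=
  sum_mul_extend s _ _

lemma extendCoef_dotProduct_cross (s : Finset (Fin k)) :
    (extendCoef Ω s ⬝ᵥ fun i => Ω i.succ 0) = explained Ω s := by
  rw [dotProduct_comm, dotProduct_extendCoef, explained, dotProduct]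
  exact Finset.sum_congr rfl fun i _ => mul_comm _ _

/-- On `s` the normal equations hold and off `s` the coefficient vanishes. The quadratic objective
at `extendCoef Ω s` is therefore `-explained Ω s`. -/
lemma extendCoef_dotProduct_mulVec (hΩ : Ω.PosDef) (s : Finset (Fin k)) :
    extendCoef Ω s ⬝ᵥ nuisanceCov Ω *ᵥ extendCoef Ω s = explained Ω s := by
  rw [← extendCoef_dotProduct_cross, dotProduct, dotProduct]
  refine Finset.sum_congr rfl fun i _ => ?_
  by_cases hi : i ∈ s
  · rw [nuisanceCov_mulVec_extendCoef hΩ hi]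
  · simp [extendCoef, hi]

lemma extendCoef_nonneg {s : Finset (Fin k)} (hs : ∀ i, 0 ≤ regCoef Ω s i) :
    0 ≤ extendCoef Ω s := by
  intro i
  by_cases hi : i ∈ s
  · simpa [extendCoef, hi] using hs ⟨i, hi⟩
  · simp [extendCoef, hi]

lemma exists_isBestSubvector (Ω : Matrix (Fin (k + 1)) (Fin (k + 1)) ℝ) :
    ∃ s, IsBestSubvector Ω s := by
  classical
  obtain ⟨s, hs, hmax⟩ := (Finset.univ.filter fun s : Finset (Fin k) =>
    ∀ i, 0 ≤ regCoef Ω s i).exists_max_image (explained Ω)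
    ⟨∅, Finset.mem_filter.2 ⟨Finset.mem_univ _, fun i => absurd i.2 (Finset.notMem_empty _)⟩⟩
  exact ⟨s, (Finset.mem_filter.1 hs).2,
    fun t ht => hmax t (Finset.mem_filter.2 ⟨Finset.mem_univ _, ht⟩)⟩

/-- At a best subvector, the residual of `Y_β` is nonpositively correlated with all of `Y_δ`. -/
lemma IsBestSubvector.cross_le (hΩ : Ω.PosDef) {s : Finset (Fin k)} (hs : IsBestSubvector Ω s)
    (i : Fin k) : Ω i.succ 0 ≤ (nuisanceCov Ω *ᵥ extendCoef Ω s) i := by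
  have hM := nuisanceCov_posDef hΩ
  obtain ⟨w, hw, hmin⟩ := exists_isMinOn_nonneg_quadratic hM fun i => Ω i.succ 0
  have hkkt := kkt_of_isMinOn_nonneg_quadratic hM.isHermitian hw hmin
  -- On the support of the minimizer the first-order conditions are equalities, namely the normal
  -- equations for `t`.
  set t : Finset (Fin k) := Finset.univ.filter fun i => 0 < w i with ht
  have hw0 : ∀ i, i ∉ t → w i = 0 := by
    intro i hi
    have : ¬ 0 < w i := by simpa [ht] using hi
    exact le_antisymm (not_lt.1 this) (hw i)
  have hwext : w = fun i => if h : i ∈ t then (fun j : t => w j) ⟨i, h⟩ else 0 := by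
    ext i
    by_cases hi : i ∈ t
    · simp [hi]
    · simp [hi, hw0 i hi]
  have hreg : (fun j : t => w j) = regCoef Ω t := by
    rw [eq_regCoef_iff hΩ]
    intro i
    have hi : 0 < w i := (Finset.mem_filter.1 i.2).2
    rw [← (hkkt i).2 hi]
    conv_rhs => rw [hwext]
    exact (sum_mul_extend t (fun j : t => w j) fun j => Ω (i : Fin k).succ j.succ).symm
  have hwt : w = extendCoef Ω t := by
    rw [hwext, hreg]
    rfl
  have hfeas : ∀ j, 0 ≤ regCoef Ω t j := by
    rw [← hreg]
    exact fun j => hw j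
  -- As `t` is feasible, `-explained Ω s ≤ -explained Ω t`, which is the minimum. So the extension
  -- of `s` is itself a minimizer and obeys the first-order conditions.
  refine (kkt_of_isMinOn_nonneg_quadratic (c := fun i => Ω i.succ 0) hM.isHermitian
    (extendCoef_nonneg hs.1) (fun v hv => ?_) i).1
  refine le_trans ?_ (hmin v hv)
  rw [hwt, extendCoef_dotProduct_mulVec hΩ, extendCoef_dotProduct_mulVec hΩ,
    extendCoef_dotProduct_cross, extendCoef_dotProduct_cross]
  linarith [hs.2 t hfeas]

/-- The coefficient vector `(1, -Ω_{βδ(s)} Ω_{δ(s)δ(s)}⁻¹)`, filled up with zeros. -/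
noncomputable def residualVector (Ω : Matrix (Fin (k + 1)) (Fin (k + 1)) ℝ)
    (s : Finset (Fin k)) : EuclideanSpace ℝ (Fin (k + 1)) :=
  meanVector 1 (-extendCoef Ω s)

lemma residualVector_zero (s : Finset (Fin k)) : residualVector Ω s 0 = 1 := rfl

lemma residualVector_succ (s : Finset (Fin k)) (i : Fin k) :
    residualVector Ω s i.succ = -extendCoef Ω s i := rfl

lemma mulVec_residualVector_zero (hΩ : Ω.PosDef) (hcorr : Ω 0 0 = 1) (s : Finset (Fin k)) :
    (Ω *ᵥ residualVector Ω s) 0 = 1 - explained Ω s := by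
  rw [mulVec, dotProduct, Fin.sum_univ_succ, residualVector_zero, hcorr,
    ← extendCoef_dotProduct_cross, dotProduct]
  simp only [residualVector_succ, mul_neg, Finset.sum_neg_distrib, mul_one, sub_eq_add_neg]
  congr 2
  refine Finset.sum_congr rfl fun i _ => ?_
  rw [posDef_apply_comm hΩ 0, mul_comm]

lemma mulVec_residualVector_succ (s : Finset (Fin k)) (i : Fin k) :
    (Ω *ᵥ residualVector Ω s) i.succ = Ω i.succ 0 - (nuisanceCov Ω *ᵥ extendCoef Ω s) i := by
  rw [mulVec, dotProduct, Fin.sum_univ_succ, residualVector_zero]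
  simp only [residualVector_succ, mul_neg, Finset.sum_neg_distrib, mul_one, sub_eq_add_neg]
  rfl

/-- The residual is uncorrelated with each regressor in `s`, so its variance equals its covariance
with `Y_β`. -/
lemma residualVector_dotProduct_mulVec (hΩ : Ω.PosDef) (hcorr : Ω 0 0 = 1) (s : Finset (Fin k)) :
    residualVector Ω s ⬝ᵥ Ω *ᵥ residualVector Ω s = 1 - explained Ω s := by
  rw [dotProduct, Fin.sum_univ_succ, mulVec_residualVector_zero hΩ hcorr, residualVector_zero]
  have : ∀ i : Fin k,
      residualVector Ω s i.succ * (Ω *ᵥ residualVector Ω s) i.succ = 0 := by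
    intro i
    rw [mulVec_residualVector_succ, residualVector_succ]
    by_cases hi : i ∈ s
    · rw [nuisanceCov_mulVec_extendCoef hΩ hi]; simp
    · simp [extendCoef, hi]
  simp [this]

lemma one_sub_explained_pos (hΩ : Ω.PosDef) (hcorr : Ω 0 0 = 1) (s : Finset (Fin k)) :
    0 < 1 - explained Ω s := by
  rw [← residualVector_dotProduct_mulVec hΩ hcorr]
  have hne : (residualVector Ω s).ofLp ≠ 0 := by
    intro h
    have := congrFun h 0
    rw [residualVector_zero] at this
    simp at this
  simpa using hΩ.dotProduct_mulVec_pos hne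

lemma isDominatedStatistic_residualVector (hΩ : Ω.PosDef) (hcorr : Ω 0 0 = 1)
    {s : Finset (Fin k)} (hs : ∀ i, 0 ≤ regCoef Ω s i) :
    IsDominatedStatistic Ω (residualVector Ω s) (Real.sqrt (1 - explained Ω s)) where
  zero_eq := rfl
  succ_nonpos i := neg_nonpos.2 (extendCoef_nonneg hs i)
  pos := Real.sqrt_pos.2 (one_sub_explained_pos hΩ hcorr s)
  variance := by
    rw [Real.sq_sqrt (one_sub_explained_pos hΩ hcorr s).le,
      residualVector_dotProduct_mulVec hΩ hcorr]
  cov_zero := by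
    rw [Real.sq_sqrt (one_sub_explained_pos hΩ hcorr s).le, mulVec_residualVector_zero hΩ hcorr]

lemma linearLB_residualVector (α : ℝ) (s : Finset (Fin k)) :
    linearLB α (Real.sqrt (1 - explained Ω s)) (residualVector Ω s) = subvectorLB Ω α s := by
  ext y
  have : inner ℝ (residualVector Ω s) y = y 0 - ∑ i, y i.succ * extendCoef Ω s i := by
    simp [PiLp.inner_apply, Fin.sum_univ_succ, residualVector_zero, residualVector_succ,
      sub_eq_add_neg]
  have h2 := dotProduct_extendCoef (Ω := Ω) s fun i => y i.succ
  rw [dotProduct] at h2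
  rw [linearLB, this, subvectorLB, h2, dotProduct]
  simp_rw [mul_comm]

lemma isDominatedStatistic_single (hcorr : Ω 0 0 = 1) :
    IsDominatedStatistic Ω (EuclideanSpace.single 0 1) 1 where
  zero_eq := by simp
  succ_nonpos i := by simp
  pos := one_pos
  variance := by simp [hcorr]
  cov_zero := by simp [hcorr]

lemma linearLB_single (α : ℝ) :
    linearLB α 1 (EuclideanSpace.single (0 : Fin (k + 1)) (1 : ℝ)) = standardLB α := by
  ext y
  simp [linearLB, standardLB, EuclideanSpace.inner_single_left]

end Subvector

/-! ### The two optimality statements. -/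

theorem proposition2 (k : ℕ) (Ω : Matrix (Fin (k + 1)) (Fin (k + 1)) ℝ)
    (hΩ : Ω.PosDef) (hcorr : ∀ i, Ω i i = 1) (α : ℝ) (hα : α ∈ Set.Ioo (0 : ℝ) 1) :
    -- Part (i): minimal maximum over `δ ≥ 0`, jointly in `β` and also at each fixed `β`,
    -- and essential uniqueness.
    (IsOptimalCI Ω α (paramSpace k) (standardLB α) ∧
      (∀ β : ℝ, IsOptimalCI Ω α {p | p ∈ paramSpace k ∧ p.1 = β} (standardLB α)) ∧
      (∀ lb : EuclideanSpace ℝ (Fin (k + 1)) → ℝ, IsOptimalCI Ω α (paramSpace k) lb →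
        ∀ p ∈ paramSpace k, lb =ᵐ[limitLaw Ω p.1 p.2] standardLB α)) ∧
    -- Part (ii): a maximizing subvector exists, and for each such subvector the interval is
    -- minimal at `δ = 0`, jointly in `β` and also at each fixed `β`, and essentially unique.
    ((∃ s : Finset (Fin k), IsBestSubvector Ω s) ∧
      ∀ s : Finset (Fin k), IsBestSubvector Ω s →
        (IsOptimalCI Ω α {p | p.2 = 0} (subvectorLB Ω α s) ∧
          (∀ β : ℝ, IsOptimalCI Ω α {(β, 0)} (subvectorLB Ω α s)) ∧
          (∀ lb : EuclideanSpace ℝ (Fin (k + 1)) → ℝ, IsOptimalCI Ω α {p | p.2 = 0} lb →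
            ∀ p ∈ paramSpace k, lb =ᵐ[limitLaw Ω p.1 p.2] subvectorLB Ω α s))) := by
  refine ⟨?_, exists_isBestSubvector Ω, fun s hs => ?_⟩
  · have h := isDominatedStatistic_single (hcorr 0)
    have hmean : ∀ p : ℝ × (Fin k → ℝ),
        inner ℝ (EuclideanSpace.single 0 1) (meanVector p.1 p.2) = p.1 := by
      intro p
      simp [meanVector, EuclideanSpace.inner_single_left]
    have hG : ∀ β t : ℝ, 0 < t → ∃ δ : Fin k → ℝ, (β, δ) ∈ paramSpace k ∧ ∀ i : Fin k,
        t / 1 ^ 2 * (Ω *ᵥ (EuclideanSpace.single 0 1 : EuclideanSpace ℝ (Fin (k + 1)))) i.succ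
          ≤ δ i :=
      -- Absolute values give a nonnegative `δ` that dominates the required shift.
      fun β t _ => ⟨fun i => |t / 1 ^ 2 *
        (Ω *ᵥ (EuclideanSpace.single 0 1 : EuclideanSpace ℝ (Fin (k + 1)))) i.succ|,
        fun i => abs_nonneg _, fun i => le_abs_self _⟩
    rw [← linearLB_single]
    refine ⟨h.isOptimalCI hΩ hα (fun p _ => hmean p) 0 (hG 0),
      fun β => h.isOptimalCI hΩ hα (fun p _ => hmean p) β fun t ht => ?_,
      fun lb hlb p _ => h.ae_eq_of_isOptimalCI hΩ hα (fun p _ => hmean p) hG hlb p⟩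
    obtain ⟨δ, h1, h2⟩ := hG β t ht
    exact ⟨δ, ⟨h1, rfl⟩, h2⟩
  · have h := isDominatedStatistic_residualVector hΩ (hcorr 0) hs.1
    have hmean : ∀ β : ℝ, inner ℝ (residualVector Ω s) (meanVector β (0 : Fin k → ℝ)) = β := by
      intro β
      simp [inner_meanVector, residualVector_zero]
    -- Maximality of `s` makes the shift nonpositive in every nuisance coordinate, so `δ = 0`
    -- already dominates it.
    have hδ : ∀ t : ℝ, 0 < t → ∀ i : Fin k, t / Real.sqrt (1 - explained Ω s) ^ 2 *
        (Ω *ᵥ residualVector Ω s) i.succ ≤ (0 : Fin k → ℝ) i := by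
      intro t ht i
      refine mul_nonpos_of_nonneg_of_nonpos (by positivity) ?_
      rw [mulVec_residualVector_succ]
      linarith [hs.cross_le hΩ i]
    rw [← linearLB_residualVector]
    have hmean' : ∀ p ∈ {p : ℝ × (Fin k → ℝ) | p.2 = 0},
        inner ℝ (residualVector Ω s) (meanVector p.1 p.2) = p.1 := by
      rintro ⟨β, δ⟩ (rfl : δ = 0)
      exact hmean β
    refine ⟨h.isOptimalCI hΩ hα hmean' 0 fun t ht => ⟨0, rfl, hδ t ht⟩,
      fun β => h.isOptimalCI hΩ hα ?_ β fun t ht => ⟨0, rfl, hδ t ht⟩,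
      fun lb hlb p _ => h.ae_eq_of_isOptimalCI hΩ hα hmean'
        (fun β t ht => ⟨0, rfl, hδ t ht⟩) hlb p⟩
    rintro p rfl
    exact hmean β
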